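/- Let $\mathbb{A}$ (term variables) and $\mathbb{P}$ (formula variables) be arbitrary disjoint sets. The formulas and terms of identity-free propositional dynamic logic $\mathrm{PDL}^-$ are given by $$\varphi,\psi ::= p \mid \varphi\to\psi \mid \mathtt{F} \mid [t]\varphi, \qquad t,s ::= a \mid t;s \mid t+s \mid t^+ \mid \varphi?;t \mid t;\varphi? \qquad (p\in\mathbb{P},\ a\in\mathbb{A}),$$ with $\neg\varphi := \varphi\to\mathtt{F}$, $\varphi\lor\psi := \neg\varphi\to\psi$, $\varphi\land\psi := \neg(\neg\varphi\lor\neg\psi)$, $\varphi\leftrightarrow\psi := (\varphi\to\psi)\land(\psi\to\varphi)$ and $\langle t\rangle\varphi := \neg[t]\neg\varphi$. A generalized structure $\mathfrak{A}$ consists of a non-empty set $|\mathfrak{A}|$, a relation $U^{\mathfrak{A}}\subseteq|\mathfrak{A}|^2$, a relation $a^{\mathfrak{A}}\subseteq U^{\mathfrak{A}}$ for each $a\in\mathbb{A}$ and a set $p^{\mathfrak{A}}\subseteq|\mathfrak{A}|$ for each $p\in\mathbb{P}$. Formulas denote subsets of $|\mathfrak{A}|$ and terms denote binary relations on $|\mathfrak{A}|$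 in the standard way: $\to$ and $\mathtt{F}$ are Boolean, $x\in[t]\varphi$ iff every $y$ with $(x,y)\in t$ satisfies $y\in\varphi$; $;$, $+$, ${}^+$ are relational composition, union and transitive closure, and $\varphi?$ is the identity relation on the set denoted by $\varphi$. A formula is valid on a class of generalized structures if it denotes $|\mathfrak{A}|$ in every member $\mathfrak{A}$ of the class. The string structure of a string $w=a_1\cdots a_n\in\mathbb{A}^*$ ($n\ge 0$) has the universe $\{0,\dots,n\}$, universal relation $\{(i,j) : i\le j\}$, $a\mapsto\{(i,i+1) : 0\le i<n,\ a_{i+1}=a\}$ for $a\in\mathbb{A}$, and $p\mapsto\emptyset$ for $p\in\mathbb{P}$. Let $\mathrm{GREL}_{\mathrm{st}}$ be the class of generalized structures whose universal relation is a finite linear order and which become isomorphic to the string structure of some $w\in\mathbb{A}^*$ when $p^{\mathfrak{A}}$ is replaced by $\emptyset$ for every $p\in\mathbb{P}$. Let $\mathrm{GREL}_{\mathrm{st}}^{<}$ be the class of all structures obtained from members $\mathfrak{A}$ of $\mathrm{GREL}_{\mathrm{st}}$ by replacing $U^{\mathfrak{A}}$ with $U^{\mathfrak{A}}\setminus\{(x,x)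 : x\in|\mathfrak{A}|\}$. Write $\vdash_{\mathrm{st}}\varphi$ if $\varphi$ is derivable by modus ponens (from $\varphi$ and $\varphi\to\psi$ infer $\psi$) and necessitation (from $\varphi$ infer $[t]\varphi$) from all substitution instances of valid propositional formulas and all instances of - $[t](\varphi\to\psi)\to([t]\varphi\to[t]\psi)$; - $[t;s]\varphi\leftrightarrow[t][s]\varphi$; - $[t+s]\varphi\leftrightarrow([t]\varphi\land[s]\varphi)$; - $[t^+]\varphi\leftrightarrow([t]\varphi\land[t][t^+]\varphi)$; - $([t]\varphi\land[t^+](\varphi\to[t]\varphi))\to[t^+]\varphi$; - $[\psi?;t]\varphi\leftrightarrow(\psi\to[t]\varphi)$; - $[t;\psi?]\varphi\leftrightarrow[t](\psi\to\varphi)$; - $[t^+]([t^+]\varphi\to\varphi)\to[t^+]\varphi$; - (Det-1) $\langle a\rangle\varphi\to[a]\varphi$ for $a\in\mathbb{A}$; - (Det-2) $\langle a\rangle\varphi\to[b]\psi$ for $a,b\in\mathbb{A}$ with $a\ne b$. Theorem. For every $\mathrm{PDL}^-$ formula $\varphi$: $\varphi$ is valid on $\mathrm{GREL}_{\mathrm{st}}^{<}$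 if and only if $\vdash_{\mathrm{st}}\varphi$. -/

import Mathlib

universe u v w w'

namespace PDLMinus

/-! ### Syntax of identity-free PDL -/

mutual

/-- Formulas over term variables `A` and formula variables `P`. -/
inductive Fml (A : Type u) (P : Type v) : Type (max u v) where
  | var : P → Fml A P
  | imp : Fml A P → Fml A P → Fml A P
  | bot : Fml A P
  | box : Term A P → Fml A P → Fml A P

/-- Terms; `testL φ t` is the term `φ? ; t` and `testR t φ` is the term `t ; φ?`. -/
inductive Term (A : Type u) (P : Type v) : Type (max u v) where
  | var : A → Term A P
  | comp : Term A P → Term A P → Term A P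
  | union : Term A P → Term A P → Term A P
  | plus : Term A P → Term A P
  | testL : Fml A P → Term A P → Term A P
  | testR : Term A P → Fml A P → Term A P

end

namespace Fml

variable {A : Type u} {P : Type v}

/-- `¬ φ`. -/
def neg (φ : Fml A P) : Fml A P := imp φ bot

/-- `φ ∨ ψ`. -/
def or (φ ψ : Fml A P) : Fml A P := imp (neg φ) ψ

/-- `φ ∧ ψ`. -/
def and (φ ψ : Fml A P) : Fml A P := neg (or (neg φ) (neg ψ))

/-- `φ ↔ ψ`. -/
def iff (φ ψ : Fml A P) : Fml A P := and (imp φ ψ) (imp ψ φ)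

/-- `⟨t⟩ φ`. -/
def dia (t : Term A P) (φ : Fml A P) : Fml A P := neg (box t (neg φ))

end Fml

/-! ### Generalized structures and semantics -/

/-- A generalized structure: a frame (a nonempty universe with a universal relation `U`) with a
binary relation contained in `U` for each term variable and a unary relation for each formula
variable. -/
structure GStruct (A : Type u) (P : Type v) where
  carrier : Type w
  nonempty : Nonempty carrier
  U : carrier → carrier → Prop
  rel : A → carrier → carrier → Prop
  rel_sub : ∀ a x y, rel a x y → U x y
  val : P → Set carrier

namespace GStruct

variable {A : Type u} {P : Type v}

mutual

/-- The set of points at which a formula holds. -/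
def fmlSem (S : GStruct.{u, v, w} A P) : Fml A P → Set S.carrier
  | .var p => S.val p
  | .imp φ ψ => {x | x ∈ fmlSem S φ → x ∈ fmlSem S ψ}
  | .bot => ∅
  | .box t φ => {x | ∀ y, termSem S t x y → y ∈ fmlSem S φ}

/-- The binary relation denoted by a term. -/
def termSem (S : GStruct.{u, v, w} A P) : Term A P → S.carrier → S.carrier → Prop
  | .var a => S.rel a
  | .comp t s => fun x z => ∃ y, termSem S t x y ∧ termSem S s y z
  | .union t s => fun x y => termSem S t x y ∨ termSem S s x y
  | .plus t => Relation.TransGen (termSem S t)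
  | .testL φ t => fun x y => x ∈ fmlSem S φ ∧ termSem S t x y
  | .testR t φ => fun x y => termSem S t x y ∧ y ∈ fmlSem S φ

end

/-- On a transitive frame the semantics is well defined: every term denotes a subrelation of the
universal relation. -/
theorem termSem_sub (S : GStruct.{u, v, w} A P)
    (hU : ∀ x y z, S.U x y → S.U y z → S.U x z) :
    ∀ (t : Term A P) (x y : S.carrier), S.termSem t x y → S.U x y
  | .var a, x, y, h => S.rel_sub a x y (by simpa only [termSem] using h)
  | .comp t s, x, y, h => by
    simp only [termSem] at h
    obtain ⟨z, h1, h2⟩ := h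
    exact hU _ _ _ (termSem_sub S hU t _ _ h1) (termSem_sub S hU s _ _ h2)
  | .union t s, x, y, h => by
    simp only [termSem] at h
    exact h.elim (termSem_sub S hU t _ _) (termSem_sub S hU s _ _)
  | .plus t, x, y, h => by
    simp only [termSem] at h
    induction h with
    | single h => exact termSem_sub S hU t _ _ h
    | tail _ h ih => exact hU _ _ _ ih (termSem_sub S hU t _ _ h)
  | .testL _ t, x, y, h => by
    simp only [termSem] at h
    exact termSem_sub S hU t _ _ h.2
  | .testR t _, x, y, h => by
    simp only [termSem] at h
    exact termSem_sub S hU t _ _ h.1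

/-- Replace the interpretation of every formula variable by the empty set. -/
def clearVal (S : GStruct.{u, v, w} A P) : GStruct.{u, v, w} A P :=
  { S with val := fun _ => ∅ }

/-- Replace the universal relation by its non-identity part; possible when the relations of the
term variables are irreflexive. -/
def strict (S : GStruct.{u, v, w} A P) (h : ∀ a x, ¬ S.rel a x x) : GStruct.{u, v, w} A P :=
  { S with
    U := fun x y => S.U x y ∧ x ≠ y
    rel_sub := fun a x y hxy => ⟨S.rel_sub a x y hxy, fun e => h a x (by rwa [← e] at hxy)⟩ }

/-- The universal relation is a finite linear order. -/
structure IsFinLin (S : GStruct.{u, v, w} A P) : Prop where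
  finite : Finite S.carrier
  refl : ∀ x, S.U x x
  trans : ∀ x y z, S.U x y → S.U y z → S.U x z
  antisymm : ∀ x y, S.U x y → S.U y x → x = y
  total : ∀ x y, S.U x y ∨ S.U y x

/-- Isomorphisms of generalized structures. -/
structure Iso (S : GStruct.{u, v, w} A P) (T : GStruct.{u, v, w'} A P) where
  toEquiv : S.carrier ≃ T.carrier
  map_U : ∀ x y, T.U (toEquiv x) (toEquiv y) ↔ S.U x y
  map_rel : ∀ a x y, T.rel a (toEquiv x) (toEquiv y) ↔ S.rel a x y
  map_val : ∀ p x, toEquiv x ∈ T.val p ↔ x ∈ S.val p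

end GStruct

/-- The string structure of `l = a₁ … aₙ`: the points are `0, …, n`, the universal relation is
`≤`, and the relation of `a` consists of the pairs `(i, i+1)` with `aᵢ₊₁ = a`. -/
def wordStruct {A : Type u} (P : Type v) (l : List A) : GStruct.{u, v, 0} A P where
  carrier := Fin (l.length + 1)
  nonempty := ⟨0⟩
  U i j := i ≤ j
  rel a i j := j.val = i.val + 1 ∧ l[i.val]? = some a
  rel_sub a i j h := by
    rw [Fin.le_def]
    omega
  val _ := ∅

/-- The class of generalized structures on finite linear orders which are isomorphic to some
string structure after the formula variables have been reinterpreted as empty. -/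
def GRELst (A : Type u) (P : Type v) : Set (GStruct.{u, v, w} A P) :=
  {S | S.IsFinLin ∧ ∃ l : List A, Nonempty (S.clearVal.Iso (wordStruct P l))}

theorem GRELst.irrefl {A : Type u} {P : Type v} {S : GStruct.{u, v, w} A P}
    (hS : S ∈ GRELst A P) (a : A) (x : S.carrier) : ¬ S.rel a x x := by
  obtain ⟨_, l, ⟨e⟩⟩ := hS
  intro h
  have h1 := ((e.map_rel a x x).2 h).1
  omega

/-- The class of strict versions of the members of `GRELst`. -/
def GRELsts (A : Type u) (P : Type v) : Set (GStruct.{u, v, w} A P) :=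
  {T | ∃ (S : GStruct.{u, v, w} A P) (hS : S ∈ GRELst A P), T = S.strict (GRELst.irrefl hS)}

/-- Validity of a formula on a class of generalized structures. -/
def Valid {A : Type u} {P : Type v} (K : Set (GStruct.{u, v, w} A P)) (φ : Fml A P) : Prop :=
  ∀ S ∈ K, S.fmlSem φ = Set.univ

/-! ### The proof system -/

/-- Propositional formulas. -/
inductive PropFml : Type where
  | var : ℕ → PropFml
  | imp : PropFml → PropFml → PropFml
  | bot : PropFml

namespace PropFml

/-- Truth of a propositional formula under a valuation. -/
def eval (V : ℕ → Prop) : PropFml → Prop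
  | var n => V n
  | imp α β => eval V α → eval V β
  | bot => False

/-- Substitution of formulas for the propositional variables. -/
def subst {A : Type u} {P : Type v} (σ : ℕ → Fml A P) : PropFml → Fml A P
  | var n => σ n
  | imp α β => Fml.imp (subst σ α) (subst σ β)
  | bot => Fml.bot

end PropFml

/-- The axioms of the system for finite strict linear orders. -/
inductive SFinLinAx {A : Type u} {P : Type v} : Fml A P → Prop where
  /-- Substitution instances of valid propositional formulas. -/
  | prop (α : PropFml) (hα : ∀ V, α.eval V) (σ : ℕ → Fml A P) : SFinLinAx (α.subst σ)
  /-- `[t](φ → ψ) → ([t]φ → [t]ψ)` -/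
  | k (t : Term A P) (φ ψ : Fml A P) :
      SFinLinAx (.imp (.box t (.imp φ ψ)) (.imp (.box t φ) (.box t ψ)))
  /-- `[t ; s]φ ↔ [t][s]φ` -/
  | comp (t s : Term A P) (φ : Fml A P) :
      SFinLinAx (.iff (.box (.comp t s) φ) (.box t (.box s φ)))
  /-- `[t + s]φ ↔ [t]φ ∧ [s]φ` -/
  | union (t s : Term A P) (φ : Fml A P) :
      SFinLinAx (.iff (.box (.union t s) φ) (.and (.box t φ) (.box s φ)))
  /-- `[t⁺]φ ↔ [t]φ ∧ [t][t⁺]φ` -/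
  | plus (t : Term A P) (φ : Fml A P) :
      SFinLinAx (.iff (.box (.plus t) φ) (.and (.box t φ) (.box t (.box (.plus t) φ))))
  /-- `[t]φ ∧ [t⁺](φ → [t]φ) → [t⁺]φ` -/
  | ind (t : Term A P) (φ : Fml A P) :
      SFinLinAx (.imp (.and (.box t φ) (.box (.plus t) (.imp φ (.box t φ)))) (.box (.plus t) φ))
  /-- `[ψ? ; t]φ ↔ (ψ → [t]φ)` -/
  | testL (t : Term A P) (φ ψ : Fml A P) :
      SFinLinAx (.iff (.box (.testL ψ t) φ) (.imp ψ (.box t φ)))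
  /-- `[t ; ψ?]φ ↔ [t](ψ → φ)` -/
  | testR (t : Term A P) (φ ψ : Fml A P) :
      SFinLinAx (.iff (.box (.testR t ψ) φ) (.box t (.imp ψ φ)))
  /-- `[t⁺]([t⁺]φ → φ) → [t⁺]φ` -/
  | lob (t : Term A P) (φ : Fml A P) :
      SFinLinAx (.imp (.box (.plus t) (.imp (.box (.plus t) φ) φ)) (.box (.plus t) φ))

/-- The determinism axioms, for term variables. -/
inductive DetAx {A : Type u} {P : Type v} : Fml A P → Prop where
  /-- `⟨a⟩φ → [a]φ` -/
  | det1 (a : A) (φ : Fml A P) : DetAx (.imp (.dia (.var a) φ) (.box (.var a) φ))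
  /-- `⟨a⟩φ → [b]ψ` for `a ≠ b` -/
  | det2 (a b : A) (hab : a ≠ b) (φ ψ : Fml A P) :
      DetAx (.imp (.dia (.var a) φ) (.box (.var b) ψ))

/-- Derivability from the axioms `Ax` by modus ponens and necessitation. -/
inductive Derivable {A : Type u} {P : Type v} (Ax : Fml A P → Prop) : Fml A P → Prop where
  | ax {φ : Fml A P} (h : Ax φ) : Derivable Ax φ
  | mp {φ ψ : Fml A P} (h₁ : Derivable Ax φ) (h₂ : Derivable Ax (.imp φ ψ)) : Derivable Ax ψ
  | nec {φ : Fml A P} (t : Term A P) (h : Derivable Ax φ) : Derivable Ax (.box t φ)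

/-- Derivability in the system extended by the determinism axioms. -/
def DerivableSt {A : Type u} {P : Type v} (φ : Fml A P) : Prop :=
  Derivable (fun χ => SFinLinAx χ ∨ DetAx χ) φ

end PDLMinus

/-!
Soundness is a routine induction; the Löb axiom holds because every term denotes a subrelation of
a finite strict order.

For completeness, a formula `φ` that is not derivable is refuted on a word. Points of the word are
described by maximal consistent sets restricted to a finite list `Ω` of formulas, their
*profiles*. Since terms are identity-free, the axioms unroll every formula `[t]χ` into a Boolean
combination of formula variables and formulas `[a]χ'`, where `a` is a term variable, so that `χ'` is
evaluated at strictly later points only; `Ω` collects these (`Fml.lits`, `Term.lits`). On a *finite*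
sequence of profiles, whose consecutive members are linked by an `a`-step between maximal consistent
sets and whose last member admits no step for a term variable occurring in `Ω`, membership and truth
therefore coincide by well-founded induction along the order (`truth_lemma`), the determinism axioms
providing the case of `[a]χ'`.

It remains to find such a finite sequence starting from the profile of any maximal consistent set
(`IsMCS.startsRun_profile`). As `Ω` is finite, a single formula `γ` expresses that the profile of
the set at hand starts such a sequence (`exists_mem_iff_profile`). With `t` the sum of the relevant
term variables, `[t]γ → γ` is derivable: a set admitting no step is itself the end of a sequence,
and a step to a set containing `γ` can be prepended. The Löb axiom for `t⁺` then makes `γ` derivable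
(`DerivableSt.of_box_imp`). In particular the induction axiom is not needed for completeness.
-/

namespace PDLMinus

open Fml

variable {A : Type u} {P : Type v}

/-! ### Soundness -/

theorem PropFml.mem_fmlSem_subst (S : GStruct.{u, v, w} A P) (σ : ℕ → Fml A P) (x : S.carrier) :
    ∀ α : PropFml, x ∈ S.fmlSem (α.subst σ) ↔ α.eval fun n => x ∈ S.fmlSem (σ n)
  | .var n => Iff.rfl
  | .imp α β => by
    simp only [PropFml.subst, PropFml.eval, GStruct.fmlSem, Set.mem_ofPred_eq,
      PropFml.mem_fmlSem_subst S σ x α, PropFml.mem_fmlSem_subst S σ x β]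
  | .bot => by simp [PropFml.subst, PropFml.eval, GStruct.fmlSem]

theorem GStruct.mem_fmlSem_and (S : GStruct.{u, v, w} A P) (x : S.carrier) (φ ψ : Fml A P) :
    x ∈ S.fmlSem (Fml.and φ ψ) ↔ x ∈ S.fmlSem φ ∧ x ∈ S.fmlSem ψ := by
  simp only [Fml.and, Fml.or, Fml.neg, GStruct.fmlSem, Set.mem_ofPred_eq,
    Set.mem_empty_iff_false]
  tauto

theorem GStruct.mem_fmlSem_iff (S : GStruct.{u, v, w} A P) (x : S.carrier) (φ ψ : Fml A P) :
    x ∈ S.fmlSem (Fml.iff φ ψ) ↔ (x ∈ S.fmlSem φ ↔ x ∈ S.fmlSem ψ) := by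
  rw [Fml.iff, GStruct.mem_fmlSem_and]
  simp only [GStruct.fmlSem, Set.mem_ofPred_eq]
  tauto

theorem GStruct.IsFinLin.strict_trans {S : GStruct.{u, v, w} A P} (hS : S.IsFinLin)
    (h : ∀ a x, ¬ S.rel a x x) (x y z : S.carrier) (hxy : (S.strict h).U x y)
    (hyz : (S.strict h).U y z) : (S.strict h).U x z := by
  refine ⟨hS.trans _ _ _ hxy.1 hyz.1, ?_⟩
  rintro rfl
  exact hxy.2 (hS.antisymm _ _ hxy.1 hyz.1)

theorem GStruct.IsFinLin.wellFounded_strict {S : GStruct.{u, v, w} A P} (hS : S.IsFinLin)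
    (h : ∀ a x, ¬ S.rel a x x) : WellFounded fun y x => (S.strict h).U x y := by
  have : Finite (S.strict h).carrier := hS.finite
  have : IsTrans (S.strict h).carrier fun y x => (S.strict h).U x y :=
    ⟨fun x y z hxy hyz => hS.strict_trans h _ _ _ hyz hxy⟩
  have : Std.Irrefl fun y x => (S.strict h).U x y := ⟨fun x hx => hx.2 rfl⟩
  exact Finite.wellFounded_of_trans_of_irrefl _

theorem forall_transGen_iff {α : Type*} {r : α → α → Prop} {p : α → Prop} {x : α} :
    (∀ y, Relation.TransGen r x y → p y) ↔
      (∀ y, r x y → p y) ∧ ∀ y, r x y → ∀ z, Relation.TransGen r y z → p z := by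
  constructor
  · exact fun h => ⟨fun y hy => h y (.single hy), fun y hy z hz => h z (.head hy hz)⟩
  · rintro ⟨h1, h2⟩ z hz
    rcases Relation.TransGen.head'_iff.1 hz with ⟨y, hy, hyz⟩
    rcases Relation.reflTransGen_iff_eq_or_transGen.1 hyz with rfl | hyz
    · exact h1 _ hy
    · exact h2 y hy z hyz

theorem SFinLinAx.sound {S : GStruct.{u, v, w} A P} (htrans : ∀ x y z, S.U x y → S.U y z → S.U x z)
    (hwf : WellFounded fun y x => S.U x y) {φ : Fml A P} (h : SFinLinAx φ) (x : S.carrier) :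
    x ∈ S.fmlSem φ := by
  cases h with
  | prop α hα σ => exact (PropFml.mem_fmlSem_subst S σ x α).2 (hα _)
  | k t φ ψ =>
    simp only [GStruct.fmlSem, Set.mem_ofPred_eq]
    exact fun h1 h2 y hy => h1 y hy (h2 y hy)
  | comp t s φ =>
    rw [S.mem_fmlSem_iff]
    simp only [GStruct.fmlSem, GStruct.termSem, Set.mem_ofPred_eq]
    grind
  | union t s φ =>
    rw [S.mem_fmlSem_iff, S.mem_fmlSem_and]
    simp only [GStruct.fmlSem, GStruct.termSem, Set.mem_ofPred_eq]
    grind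
  | plus t φ =>
    rw [S.mem_fmlSem_iff, S.mem_fmlSem_and]
    simp only [GStruct.fmlSem, GStruct.termSem, Set.mem_ofPred_eq]
    exact forall_transGen_iff
  | ind t φ =>
    rw [GStruct.fmlSem, Set.mem_ofPred_eq, S.mem_fmlSem_and]
    simp only [GStruct.fmlSem, GStruct.termSem, Set.mem_ofPred_eq]
    rintro ⟨h1, h2⟩ y hy
    induction hy with
    | single hy => exact h1 _ hy
    | tail hy hz ih => exact h2 _ hy ih _ hz
  | testL t φ ψ =>
    rw [S.mem_fmlSem_iff]
    simp only [GStruct.fmlSem, GStruct.termSem, Set.mem_ofPred_eq]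
    grind
  | testR t φ ψ =>
    rw [S.mem_fmlSem_iff]
    simp only [GStruct.fmlSem, GStruct.termSem, Set.mem_ofPred_eq]
    grind
  | lob t φ =>
    simp only [GStruct.fmlSem, GStruct.termSem, Set.mem_ofPred_eq]
    intro h y
    induction y using hwf.induction with
    | _ y ih =>
      intro hy
      refine h y hy fun z hz => ih z ?_ (hy.trans hz)
      exact S.termSem_sub htrans (.plus t) y z (by simpa only [GStruct.termSem] using hz)

theorem DetAx.sound {S : GStruct.{u, v, w} A P} (hS : S ∈ GRELst A P) {φ : Fml A P}
    (h : DetAx φ) (x : S.carrier) : x ∈ (S.strict (GRELst.irrefl hS)).fmlSem φ := by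
  obtain ⟨_, l, ⟨e⟩⟩ := hS
  cases h with
  | det1 a φ =>
    simp only [Fml.dia, Fml.neg, GStruct.fmlSem, GStruct.termSem, Set.mem_ofPred_eq,
      Set.mem_empty_iff_false]
    intro h y hy
    by_contra hφ
    refine h fun z hz hzφ => hφ ?_
    have h1 := ((e.map_rel a x y).2 hy).1
    have h2 := ((e.map_rel a x z).2 hz).1
    have : y = z := e.toEquiv.injective (Fin.ext (h1.trans h2.symm))
    rwa [this]
  | det2 a b hab φ ψ =>
    simp only [Fml.dia, Fml.neg, GStruct.fmlSem, GStruct.termSem, Set.mem_ofPred_eq,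
      Set.mem_empty_iff_false]
    intro h y hy
    refine (h fun z hz _ => hab ?_).elim
    have h1 := ((e.map_rel b x y).2 hy).2
    have h2 := ((e.map_rel a x z).2 hz).2
    exact Option.some.inj (h2.symm.trans h1)

theorem DerivableSt.valid {φ : Fml A P} (h : DerivableSt φ) :
    Valid (GRELsts.{u, v, w} A P) φ := by
  rintro _ ⟨S, hS, rfl⟩
  refine Set.eq_univ_of_forall ?_
  induction h with
  | ax h =>
    rcases h with h | h
    · exact h.sound (hS.1.strict_trans _) (hS.1.wellFounded_strict _)
    · exact h.sound hS
  | mp _ _ ih1 ih2 => exact fun x => ih2 x (ih1 x)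
  | nec t _ ih =>
    intro x
    simp only [GStruct.fmlSem, Set.mem_ofPred_eq]
    exact fun y _ => ih y

/-! ### Maximal consistent sets -/

/-- Derivability from a set of local hypotheses, to which necessitation does not apply. -/
inductive Ded (Γ : Set (Fml A P)) : Fml A P → Prop where
  | thm {φ : Fml A P} (h : DerivableSt φ) : Ded Γ φ
  | hyp {φ : Fml A P} (h : φ ∈ Γ) : Ded Γ φ
  | mp {φ ψ : Fml A P} (h₁ : Ded Γ φ) (h₂ : Ded Γ (.imp φ ψ)) : Ded Γ ψ

theorem derivableSt_of_sfinLinAx {φ : Fml A P} (h : SFinLinAx φ) : DerivableSt φ :=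
  .ax (.inl h)

theorem derivableSt_k (φ ψ : Fml A P) : DerivableSt (.imp φ (.imp ψ φ)) :=
  derivableSt_of_sfinLinAx (.prop (.imp (.var 0) (.imp (.var 1) (.var 0)))
    (by simp only [PropFml.eval]; tauto) fun n => if n = 0 then φ else ψ)

theorem derivableSt_s (φ ψ χ : Fml A P) :
    DerivableSt (.imp (.imp φ (.imp ψ χ)) (.imp (.imp φ ψ) (.imp φ χ))) :=
  derivableSt_of_sfinLinAx (.prop
    (.imp (.imp (.var 0) (.imp (.var 1) (.var 2)))
      (.imp (.imp (.var 0) (.var 1)) (.imp (.var 0) (.var 2))))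
    (by simp only [PropFml.eval]; tauto) fun n => if n = 0 then φ else if n = 1 then ψ else χ)

theorem derivableSt_id (φ : Fml A P) : DerivableSt (.imp φ φ) :=
  derivableSt_of_sfinLinAx (.prop (.imp (.var 0) (.var 0))
    (by simp only [PropFml.eval]; tauto) fun _ => φ)

theorem derivableSt_efq (φ ψ : Fml A P) : DerivableSt (.imp (neg φ) (.imp φ ψ)) :=
  derivableSt_of_sfinLinAx (.prop
    (.imp (.imp (.var 0) .bot) (.imp (.var 0) (.var 1)))
    (by simp only [PropFml.eval]; tauto) fun n => if n = 0 then φ else ψ)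

theorem derivableSt_dne (φ : Fml A P) : DerivableSt (.imp (neg (neg φ)) φ) :=
  derivableSt_of_sfinLinAx (.prop (.imp (.imp (.imp (.var 0) .bot) .bot) (.var 0))
    (by simp only [PropFml.eval]; tauto) fun _ => φ)

theorem derivableSt_exfalso (φ : Fml A P) : DerivableSt (.imp .bot φ) :=
  derivableSt_of_sfinLinAx (.prop (.imp .bot (.var 0))
    (by simp only [PropFml.eval]; tauto) fun _ => φ)

theorem Ded.imp_intro {Γ : Set (Fml A P)} {φ ψ : Fml A P} (h : Ded (insert φ Γ) ψ) :
    Ded Γ (.imp φ ψ) := by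
  induction h with
  | thm h => exact .mp (.thm h) (.thm (derivableSt_k _ _))
  | hyp h =>
    rcases h with rfl | h
    · exact .thm (derivableSt_id _)
    · exact .mp (.hyp h) (.thm (derivableSt_k _ _))
  | mp _ _ ih1 ih2 => exact .mp ih1 (.mp ih2 (.thm (derivableSt_s _ _ _)))

theorem Ded.mono {Γ Δ : Set (Fml A P)} (hΓ : Γ ⊆ Δ) {φ : Fml A P} (h : Ded Γ φ) : Ded Δ φ := by
  induction h with
  | thm h => exact .thm h
  | hyp h => exact .hyp (hΓ h)
  | mp _ _ ih1 ih2 => exact .mp ih1 ih2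

theorem Ded.derivableSt {φ : Fml A P} (h : Ded ∅ φ) : DerivableSt φ := by
  induction h with
  | thm h => exact h
  | hyp h => exact h.elim
  | mp _ _ ih1 ih2 => exact .mp ih1 ih2

theorem Ded.exists_of_sUnion {c : Set (Set (Fml A P))} (hc : IsChain (· ⊆ ·) c)
    (hne : c.Nonempty) {φ : Fml A P} (h : Ded (⋃₀ c) φ) : ∃ Γ ∈ c, Ded Γ φ := by
  induction h with
  | thm h => exact ⟨_, hne.some_mem, .thm h⟩
  | hyp h =>
    obtain ⟨Γ, hΓ, h⟩ := h
    exact ⟨Γ, hΓ, .hyp h⟩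
  | mp _ _ ih1 ih2 =>
    obtain ⟨Γ, hΓ, h1⟩ := ih1
    obtain ⟨Δ, hΔ, h2⟩ := ih2
    rcases hc.total hΓ hΔ with h | h
    · exact ⟨Δ, hΔ, .mp (h1.mono h) h2⟩
    · exact ⟨Γ, hΓ, .mp h1 (h2.mono h)⟩

/-- Maximal consistent sets of formulas. -/
structure IsMCS (M : Set (Fml A P)) : Prop where
  not_ded_bot : ¬ Ded M .bot
  ded_bot_of_notMem : ∀ φ ∉ M, Ded (insert φ M) .bot

theorem exists_isMCS {Γ : Set (Fml A P)} (hΓ : ¬ Ded Γ .bot) : ∃ M, Γ ⊆ M ∧ IsMCS M := by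
  obtain ⟨M, hΓM, hM⟩ := zorn_subset_nonempty {Δ : Set (Fml A P) | ¬ Ded Δ .bot}
    (fun c hc hchain hne => ⟨⋃₀ c, fun h => by
      obtain ⟨Δ, hΔ, h⟩ := Ded.exists_of_sUnion hchain hne h
      exact hc hΔ h, fun Δ hΔ => Set.subset_sUnion_of_mem hΔ⟩) Γ hΓ
  refine ⟨M, hΓM, hM.prop, fun φ hφ => ?_⟩
  by_contra h
  exact hφ (hM.le_of_ge h (Set.subset_insert _ _) (Set.mem_insert _ _))

namespace IsMCS

variable {M : Set (Fml A P)}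

theorem mem_of_ded (hM : IsMCS M) {φ : Fml A P} (h : Ded M φ) : φ ∈ M := by
  by_contra hφ
  exact hM.not_ded_bot (.mp h (hM.ded_bot_of_notMem φ hφ).imp_intro)

theorem mem_of_derivableSt (hM : IsMCS M) {φ : Fml A P} (h : DerivableSt φ) : φ ∈ M :=
  hM.mem_of_ded (.thm h)

theorem bot_notMem (hM : IsMCS M) : Fml.bot ∉ M := fun h => hM.not_ded_bot (.hyp h)

theorem imp_mem_iff (hM : IsMCS M) {φ ψ : Fml A P} : .imp φ ψ ∈ M ↔ (φ ∈ M → ψ ∈ M) := by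
  constructor
  · exact fun h hφ => hM.mem_of_ded (.mp (.hyp hφ) (.hyp h))
  · intro h
    by_cases hφ : φ ∈ M
    · exact hM.mem_of_ded (.mp (.hyp (h hφ)) (.thm (derivableSt_k _ _)))
    · exact hM.mem_of_ded (.mp (hM.ded_bot_of_notMem φ hφ).imp_intro
        (.thm (derivableSt_efq _ _)))

theorem neg_mem_iff (hM : IsMCS M) {φ : Fml A P} : neg φ ∈ M ↔ φ ∉ M := by
  rw [neg, hM.imp_mem_iff]
  exact ⟨fun h hφ => hM.bot_notMem (h hφ), fun h hφ => (h hφ).elim⟩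

theorem and_mem_iff (hM : IsMCS M) {φ ψ : Fml A P} : Fml.and φ ψ ∈ M ↔ φ ∈ M ∧ ψ ∈ M := by
  rw [Fml.and, hM.neg_mem_iff, Fml.or, hM.imp_mem_iff, hM.neg_mem_iff, hM.neg_mem_iff,
    hM.neg_mem_iff]
  tauto

theorem iff_mem_iff (hM : IsMCS M) {φ ψ : Fml A P} : Fml.iff φ ψ ∈ M ↔ (φ ∈ M ↔ ψ ∈ M) := by
  rw [Fml.iff, hM.and_mem_iff, hM.imp_mem_iff, hM.imp_mem_iff]
  tauto

theorem mem_iff_of_sfinLinAx (hM : IsMCS M) {φ ψ : Fml A P} (h : SFinLinAx (.iff φ ψ)) :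
    φ ∈ M ↔ ψ ∈ M :=
  hM.iff_mem_iff.1 (hM.mem_of_derivableSt (derivableSt_of_sfinLinAx h))

theorem box_mem_of_ded (hM : IsMCS M) {t : Term A P} {φ : Fml A P}
    (h : Ded {χ | .box t χ ∈ M} φ) : .box t φ ∈ M := by
  induction h with
  | thm h => exact hM.mem_of_derivableSt (.nec t h)
  | hyp h => exact h
  | mp _ _ ih1 ih2 =>
    exact hM.imp_mem_iff.1 (hM.imp_mem_iff.1
      (hM.mem_of_derivableSt (derivableSt_of_sfinLinAx (.k t _ _))) ih2) ih1

theorem box_mem_of_box_bot_mem (hM : IsMCS M) {t : Term A P} (h : .box t .bot ∈ M)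
    (φ : Fml A P) : .box t φ ∈ M := by
  exact hM.box_mem_of_ded (.mp (.hyp h) (.thm (derivableSt_exfalso φ)))

end IsMCS

theorem derivableSt_of_forall_isMCS {φ : Fml A P} (h : ∀ M, IsMCS M → φ ∈ M) :
    DerivableSt φ := by
  by_contra hφ
  have hcons : ¬ Ded {neg φ} Fml.bot := fun hd => by
    rw [← insert_empty_eq] at hd
    exact hφ (.mp hd.imp_intro.derivableSt (derivableSt_dne φ))
  obtain ⟨M, hM, hMCS⟩ := exists_isMCS hcons
  exact hMCS.neg_mem_iff.1 (hM rfl) (h M hMCS)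

/-! ### Steps between maximal consistent sets -/

/-- `N` is a successor of `M` for the term variable `a`, which is possible in `M`. -/
structure IsStep (a : A) (M N : Set (Fml A P)) : Prop where
  left : IsMCS M
  right : IsMCS N
  box_bot_notMem : .box (.var a) .bot ∉ M
  mem_of_box_mem : ∀ χ, .box (.var a) χ ∈ M → χ ∈ N

theorem IsMCS.exists_isStep {M : Set (Fml A P)} (hM : IsMCS M) {a : A}
    (h : .box (.var a) .bot ∉ M) : ∃ N, IsStep a M N := by
  obtain ⟨N, hMN, hN⟩ := exists_isMCS (Γ := {χ | .box (.var a) χ ∈ M})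
    fun hd => h (hM.box_mem_of_ded hd)
  exact ⟨N, hM, hN, h, fun χ hχ => hMN hχ⟩

namespace IsStep

variable {a : A} {M N : Set (Fml A P)}

theorem box_mem_iff (h : IsStep a M N) {χ : Fml A P} : .box (.var a) χ ∈ M ↔ χ ∈ N := by
  refine ⟨h.mem_of_box_mem χ, fun hχ => ?_⟩
  have hdet := h.left.mem_of_derivableSt (.ax (.inr (DetAx.det1 a χ)))
  refine h.left.imp_mem_iff.1 hdet (h.left.neg_mem_iff.2 fun hneg => ?_)
  exact h.right.neg_mem_iff.1 (h.mem_of_box_mem _ hneg) hχ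

theorem box_mem_of_ne (h : IsStep a M N) {b : A} (hab : a ≠ b) (χ : Fml A P) :
    .box (.var b) χ ∈ M := by
  have hdet := h.left.mem_of_derivableSt (.ax (.inr (DetAx.det2 a b hab (neg .bot) χ)))
  refine h.left.imp_mem_iff.1 hdet (h.left.neg_mem_iff.2 fun hneg => ?_)
  exact h.right.neg_mem_iff.1 (h.mem_of_box_mem _ hneg)
    (h.right.neg_mem_iff.2 h.right.bot_notMem)

end IsStep

/-! ### Literals and profiles -/

mutual

/-- The formula variables and the formulas `[a]χ`, for term variables `a`, that occur when a formula
is unrolled by means of the axioms. -/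
def Fml.lits : Fml A P → List (Fml A P)
  | .var p => [.var p]
  | .imp φ ψ => Fml.lits φ ++ Fml.lits ψ
  | .bot => []
  | .box t φ => Term.lits t φ ++ Fml.lits φ

/-- The literals that occur when the outermost box of `[t]χ` is unrolled. The literals of the tests
in `t` are included, those of `χ` are not. -/
def Term.lits : Term A P → Fml A P → List (Fml A P)
  | .var a, χ => [.box (.var a) χ]
  | .comp t s, χ => Term.lits t (.box s χ) ++ Term.lits s χ
  | .union t s, χ => Term.lits t χ ++ Term.lits s χ
  | .plus t, χ => Term.lits t χ ++ Term.lits t (.box (.plus t) χ)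
  | .testL ψ t, χ => Fml.lits ψ ++ Term.lits t χ
  | .testR t ψ, χ => Fml.lits ψ ++ Term.lits t (.imp ψ χ)

end

/-- The part of `M` within the list `Ω`. -/
def profile (Ω : List (Fml A P)) (M : Set (Fml A P)) : Set (Fml A P) :=
  {χ | χ ∈ Ω ∧ χ ∈ M}

theorem mem_iff_of_profile_eq {Ω : List (Fml A P)} {M N : Set (Fml A P)}
    (h : profile Ω M = profile Ω N) {χ : Fml A P} (hχ : χ ∈ Ω) : χ ∈ M ↔ χ ∈ N := by
  have := Set.ext_iff.1 h χ
  simpa only [profile, Set.mem_ofPred_eq, hχ, true_and] using this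

/-- As the list `Ω` is finite, every property of profiles is expressed by a formula. -/
theorem exists_mem_iff_profile (Ω : List (Fml A P)) (Q : Set (Fml A P) → Prop) :
    ∃ γ : Fml A P, ∀ M, IsMCS M → (γ ∈ M ↔ Q (profile Ω M)) := by
  induction Ω generalizing Q with
  | nil =>
    have h0 (M : Set (Fml A P)) : profile [] M = ∅ := by simp [profile]
    by_cases hQ : Q ∅
    · refine ⟨neg .bot, fun M hM => ?_⟩
      simp [h0, hQ, hM.neg_mem_iff, hM.bot_notMem]
    · refine ⟨.bot, fun M hM => ?_⟩
      simp [h0, hQ, hM.bot_notMem]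
  | cons ψ Ω ih =>
    obtain ⟨γ₁, h1⟩ := ih fun X => Q (insert ψ X)
    obtain ⟨γ₂, h2⟩ := ih Q
    refine ⟨.and (.imp ψ γ₁) (.imp (neg ψ) γ₂), fun M hM => ?_⟩
    rw [hM.and_mem_iff, hM.imp_mem_iff, hM.imp_mem_iff, hM.neg_mem_iff, h1 M hM, h2 M hM]
    by_cases hψ : ψ ∈ M
    · have : profile (ψ :: Ω) M = insert ψ (profile Ω M) := by
        ext χ
        simp only [profile, List.mem_cons, Set.mem_ofPred_eq, Set.mem_insert_iff]
        grind
      simp [hψ, this]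
    · have : profile (ψ :: Ω) M = profile Ω M := by
        ext χ
        simp only [profile, List.mem_cons, Set.mem_ofPred_eq]
        grind
      simp [hψ, this]

/-! ### The truth lemma -/

/-- A labelling of the points of a structure by profiles of maximal consistent sets which respects
the literals in `Ω`. A literal `[a]χ` is compared with the membership of `χ` in chosen sets `N y`
because `χ` need not belong to `Ω`, so that the profile of `y` does not by itself decide it. -/
structure IsLabelling (S : GStruct.{u, v, w} A P) (Ω : List (Fml A P))
    (X : S.carrier → Set (Fml A P)) : Prop where
  mem_val_iff : ∀ x p, x ∈ S.val p ↔ .var p ∈ X x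
  box_mem_iff : ∀ x a χ M, .box (.var a) χ ∈ Ω → IsMCS M → profile Ω M = X x →
    ∃ N : S.carrier → Set (Fml A P),
      (∀ y, S.rel a x y → IsMCS (N y) ∧ profile Ω (N y) = X y) ∧
      (.box (.var a) χ ∈ M ↔ ∀ y, S.rel a x y → χ ∈ N y)

section Truth

variable {S : GStruct.{u, v, w} A P} {Ω : List (Fml A P)} {X : S.carrier → Set (Fml A P)}

-- All terms are identity-free, so the induction hypothesis is needed at strictly later points only.
mutual

/-- Membership and truth agree at `x`, provided that they do at all later points. -/
theorem mem_iff_mem_fmlSem (hX : IsLabelling S Ω X)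
    (x : S.carrier) (ih : ∀ y, S.U x y → ∀ N, IsMCS N → profile Ω N = X y →
      ∀ χ : Fml A P, χ.lits ⊆ Ω → (χ ∈ N ↔ y ∈ S.fmlSem χ))
    (M : Set (Fml A P)) (hM : IsMCS M) (hMX : profile Ω M = X x) :
    ∀ φ : Fml A P, φ.lits ⊆ Ω → (φ ∈ M ↔ x ∈ S.fmlSem φ)
  | .var p, hΩ => by
    have hp : Fml.var p ∈ Ω := hΩ (by simp [Fml.lits])
    simp only [GStruct.fmlSem, hX.mem_val_iff, ← hMX, profile, Set.mem_ofPred_eq, hp, true_and]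
  | .imp φ ψ, hΩ => by
    simp only [Fml.lits, List.append_subset] at hΩ
    simp only [GStruct.fmlSem, Set.mem_ofPred_eq, hM.imp_mem_iff,
      mem_iff_mem_fmlSem hX x ih M hM hMX φ hΩ.1,
      mem_iff_mem_fmlSem hX x ih M hM hMX ψ hΩ.2]
  | .bot, _ => by simp [GStruct.fmlSem, hM.bot_notMem]
  | .box t φ, hΩ => by
    simp only [Fml.lits, List.append_subset] at hΩ
    simp only [GStruct.fmlSem, Set.mem_ofPred_eq,
      box_mem_iff_forall_termSem hX x ih M hM hMX t φ hΩ.1 hΩ.2]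

/-- The case of boxes of `mem_iff_mem_fmlSem`; as `[t⁺]χ` is unrolled to `[t][t⁺]χ`, the formula in
the scope of the box may be larger in the recursive calls. -/
theorem box_mem_iff_forall_termSem (hX : IsLabelling S Ω X)
    (x : S.carrier) (ih : ∀ y, S.U x y → ∀ N, IsMCS N → profile Ω N = X y →
      ∀ χ : Fml A P, χ.lits ⊆ Ω → (χ ∈ N ↔ y ∈ S.fmlSem χ))
    (M : Set (Fml A P)) (hM : IsMCS M) (hMX : profile Ω M = X x) :
    ∀ (t : Term A P) (χ : Fml A P), t.lits χ ⊆ Ω → χ.lits ⊆ Ω →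
      (.box t χ ∈ M ↔ ∀ y, S.termSem t x y → y ∈ S.fmlSem χ)
  | .var a, χ, hΩ, hχ => by
    have ha : Fml.box (.var a) χ ∈ Ω := hΩ (by simp [Term.lits])
    obtain ⟨N, hN, hbox⟩ := hX.box_mem_iff x a χ M ha hM hMX
    rw [hbox]
    simp only [GStruct.termSem]
    exact forall₂_congr fun y hy =>
      ih y (S.rel_sub _ _ _ hy) (N y) (hN y hy).1 (hN y hy).2 χ hχ
  | .comp t s, χ, hΩ, hχ => by
    simp only [Term.lits, List.append_subset] at hΩ
    rw [hM.mem_iff_of_sfinLinAx (.comp t s χ),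
      box_mem_iff_forall_termSem hX x ih M hM hMX t (.box s χ) hΩ.1
        (by simp only [Fml.lits, List.append_subset]; exact ⟨hΩ.2, hχ⟩)]
    simp only [GStruct.fmlSem, GStruct.termSem, Set.mem_ofPred_eq]
    grind
  | .union t s, χ, hΩ, hχ => by
    simp only [Term.lits, List.append_subset] at hΩ
    rw [hM.mem_iff_of_sfinLinAx (.union t s χ), hM.and_mem_iff,
      box_mem_iff_forall_termSem hX x ih M hM hMX t χ hΩ.1 hχ,
      box_mem_iff_forall_termSem hX x ih M hM hMX s χ hΩ.2 hχ]
    simp only [GStruct.termSem]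
    grind
  | .plus t, χ, hΩ, hχ => by
    have hplus : (Fml.box (.plus t) χ).lits ⊆ Ω := by
      simp only [Fml.lits, List.append_subset]
      exact ⟨hΩ, hχ⟩
    simp only [Term.lits, List.append_subset] at hΩ
    rw [hM.mem_iff_of_sfinLinAx (.plus t χ), hM.and_mem_iff,
      box_mem_iff_forall_termSem hX x ih M hM hMX t χ hΩ.1 hχ,
      box_mem_iff_forall_termSem hX x ih M hM hMX t (.box (.plus t) χ) hΩ.2 hplus]
    simp only [GStruct.fmlSem, GStruct.termSem, Set.mem_ofPred_eq]
    exact forall_transGen_iff.symm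
  | .testL ψ t, χ, hΩ, hχ => by
    simp only [Term.lits, List.append_subset] at hΩ
    rw [hM.mem_iff_of_sfinLinAx (.testL t χ ψ), hM.imp_mem_iff,
      mem_iff_mem_fmlSem hX x ih M hM hMX ψ hΩ.1,
      box_mem_iff_forall_termSem hX x ih M hM hMX t χ hΩ.2 hχ]
    simp only [GStruct.termSem]
    grind
  | .testR t ψ, χ, hΩ, hχ => by
    simp only [Term.lits, List.append_subset] at hΩ
    rw [hM.mem_iff_of_sfinLinAx (.testR t χ ψ),
      box_mem_iff_forall_termSem hX x ih M hM hMX t (.imp ψ χ) hΩ.2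
        (by simp only [Fml.lits, List.append_subset]; exact ⟨hΩ.1, hχ⟩)]
    simp only [GStruct.fmlSem, GStruct.termSem, Set.mem_ofPred_eq]
    grind

end

theorem truth_lemma (hwf : WellFounded fun y x => S.U x y) (hX : IsLabelling S Ω X)
    (x : S.carrier) :
    ∀ M, IsMCS M → profile Ω M = X x →
      ∀ φ : Fml A P, φ.lits ⊆ Ω → (φ ∈ M ↔ x ∈ S.fmlSem φ) := by
  induction x using hwf.induction with
  | _ x ih => exact mem_iff_mem_fmlSem hX x ih

end Truth

/-! ### Words of profiles -/

/-- The string structure of `l`, on a universe in an arbitrary universe level, where `p` holds at the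
points `i` with `p ∈ X i`. -/
def wordModel (l : List A) (X : ℕ → Set (Fml A P)) : GStruct.{u, v, w} A P where
  carrier := ULift.{w} (Fin (l.length + 1))
  nonempty := ⟨⟨0⟩⟩
  U i j := i.down ≤ j.down
  rel a i j := j.down.val = i.down.val + 1 ∧ l[i.down.val]? = some a
  rel_sub a i j h := by
    rw [Fin.le_def]
    omega
  val p := {i | .var p ∈ X i.down.val}

theorem wordModel_mem_GRELst (l : List A) (X : ℕ → Set (Fml A P)) :
    wordModel.{u, v, w} l X ∈ GRELst.{u, v, w} A P := by
  refine ⟨⟨?_, fun x => le_refl x.down, fun x y z hxy hyz => le_trans hxy hyz,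
    fun x y hxy hyx => ULift.ext _ _ (le_antisymm hxy hyx), fun x y => le_total x.down y.down⟩,
    l, ⟨⟨Equiv.ulift, fun _ _ => Iff.rfl, fun _ _ _ => Iff.rfl, fun _ _ => Iff.rfl⟩⟩⟩
  exact inferInstanceAs (Finite (ULift.{w} (Fin (l.length + 1))))

/-- `X 0, …, X n` are the profiles along a word `l` of length `n`: consecutive profiles are realised
by a step for the corresponding letter, and the last one by a set admitting no step for the
letters in `L`. -/
structure IsRun (Ω : List (Fml A P)) (L : List A) (l : List A) (X : ℕ → Set (Fml A P)) :
    Prop where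
  step : ∀ i a, l[i]? = some a →
    ∃ M N, IsStep a M N ∧ profile Ω M = X i ∧ profile Ω N = X (i + 1)
  last : ∃ M, IsMCS M ∧ profile Ω M = X l.length ∧ ∀ a ∈ L, .box (.var a) .bot ∈ M

theorem IsRun.isLabelling {Ω : List (Fml A P)} {L l : List A} {X : ℕ → Set (Fml A P)}
    (hX : IsRun Ω L l X) (hL : ∀ a χ, .box (.var a) χ ∈ Ω → a ∈ L) :
    IsLabelling ((wordModel.{u, v, w} l X).strict
      (GRELst.irrefl (wordModel_mem_GRELst l X))) Ω fun x => X x.down.val where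
  mem_val_iff _ _ := Iff.rfl
  box_mem_iff := by
    rintro ⟨⟨i, hi⟩⟩ a χ M ha hM hMX
    change ∃ N : ULift.{w} (Fin (l.length + 1)) → Set (Fml A P),
      (∀ y : ULift.{w} (Fin (l.length + 1)), y.down.val = i + 1 ∧ l[i]? = some a → _ ∧ _ = X y.down.val) ∧
      (_ ↔ ∀ y : ULift.{w} (Fin (l.length + 1)), y.down.val = i + 1 ∧ l[i]? = some a → _)
    rcases Nat.lt_succ_iff_lt_or_eq.1 hi with hi | rfl
    · obtain ⟨M', N', h, hM', hN'⟩ := hX.step i l[i] (List.getElem?_eq_getElem hi)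
      refine ⟨fun _ => N', fun y hy => ⟨h.right, by rw [hN', hy.1]⟩, ?_⟩
      rw [mem_iff_of_profile_eq (hMX.trans hM'.symm) ha]
      by_cases hab : l[i] = a
      · subst hab
        rw [h.box_mem_iff]
        exact ⟨fun hχ _ _ => hχ, fun hall =>
          hall ⟨⟨i + 1, by omega⟩⟩ ⟨rfl, List.getElem?_eq_getElem hi⟩⟩
      · refine iff_of_true (h.box_mem_of_ne hab χ) fun y hy => (hab ?_).elim
        exact Option.some.inj ((List.getElem?_eq_getElem hi).symm.trans hy.2)
    · obtain ⟨M', h, hM', hlast⟩ := hX.last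
      refine ⟨fun _ => M', fun y hy => by simp at hy, ?_⟩
      rw [mem_iff_of_profile_eq (hMX.trans hM'.symm) ha]
      refine iff_of_true (h.box_mem_of_box_bot_mem (hlast a (hL a χ ha)) χ) fun y hy => ?_
      simp at hy

/-- Some run starts with the profile `Y`. -/
def StartsRun (Ω : List (Fml A P)) (L : List A) (Y : Set (Fml A P)) : Prop :=
  ∃ l X, IsRun Ω L l X ∧ X 0 = Y

theorem startsRun_of_last {Ω : List (Fml A P)} {L : List A} {M : Set (Fml A P)} (hM : IsMCS M)
    (h : ∀ a ∈ L, .box (.var a) .bot ∈ M) : StartsRun Ω L (profile Ω M) :=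
  ⟨[], fun _ => profile Ω M, ⟨by simp, ⟨M, hM, rfl, h⟩⟩, rfl⟩

theorem IsStep.startsRun {Ω : List (Fml A P)} {L : List A} {a : A} {M N : Set (Fml A P)}
    (h : IsStep a M N) (hN : StartsRun Ω L (profile Ω N)) : StartsRun Ω L (profile Ω M) := by
  obtain ⟨l, X, hX, hX0⟩ := hN
  refine ⟨a :: l, fun | 0 => profile Ω M | i + 1 => X i, ⟨?_, hX.last⟩, rfl⟩
  rintro (_ | i) b hb
  · obtain rfl : a = b := by simpa using hb
    exact ⟨M, N, h, rfl, hX0.symm⟩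
  · exact hX.step i b (by simpa using hb)

/-! ### Existence of runs -/

/-- The sum of the term variables in the nonempty list `a :: L`. -/
def letterSum (a : A) : List A → Term A P
  | [] => .var a
  | b :: L => .union (.var a) (letterSum b L)

theorem IsMCS.box_var_mem_of_box_letterSum_mem {M : Set (Fml A P)} (hM : IsMCS M)
    {φ : Fml A P} {a : A} {L : List A} (h : .box (letterSum a L) φ ∈ M) :
    ∀ b ∈ a :: L, .box (.var b) φ ∈ M := by
  induction L generalizing a with
  | nil => simpa [letterSum] using h
  | cons c L ih =>
    rw [letterSum, hM.mem_iff_of_sfinLinAx (.union _ _ _), hM.and_mem_iff] at h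
    intro b hb
    rcases List.mem_cons.1 hb with rfl | hb
    · exact h.1
    · exact ih h.2 b hb

/-- The Löb rule. It needs one step of `t` only, since `[t⁺]φ` implies `[t]φ`. -/
theorem DerivableSt.of_box_imp {t : Term A P} {φ : Fml A P}
    (h : DerivableSt (.imp (.box t φ) φ)) : DerivableSt φ := by
  have hplus (M : Set (Fml A P)) (hM : IsMCS M) (h' : .box (.plus t) φ ∈ M) : φ ∈ M := by
    rw [hM.mem_iff_of_sfinLinAx (.plus t φ), hM.and_mem_iff] at h'
    exact hM.imp_mem_iff.1 (hM.mem_of_derivableSt h) h'.1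
  have himp : DerivableSt (.imp (.box (.plus t) φ) φ) :=
    derivableSt_of_forall_isMCS fun M hM => hM.imp_mem_iff.2 (hplus M hM)
  exact .mp (.mp (.nec (.plus t) himp) (derivableSt_of_sfinLinAx (.lob t φ))) himp

theorem IsMCS.startsRun_profile (Ω : List (Fml A P)) (L : List A) {M : Set (Fml A P)}
    (hM : IsMCS M) : StartsRun Ω L (profile Ω M) := by
  -- There is no sum of an empty list of letters, but then every set ends a run.
  cases L with
  | nil => exact startsRun_of_last hM (by simp)
  | cons a L =>
    obtain ⟨γ, hγ⟩ := exists_mem_iff_profile Ω (StartsRun Ω (a :: L))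
    have hstep : DerivableSt (.imp (.box (letterSum a L) γ) γ) := by
      refine derivableSt_of_forall_isMCS fun M hM => hM.imp_mem_iff.2 fun h => (hγ M hM).2 ?_
      by_cases hlast : ∀ b ∈ a :: L, .box (.var b) .bot ∈ M
      · exact startsRun_of_last hM hlast
      · push Not at hlast
        obtain ⟨b, hb, hbM⟩ := hlast
        obtain ⟨N, hN⟩ := hM.exists_isStep hbM
        exact hN.startsRun ((hγ N hN.right).1
          (hN.mem_of_box_mem γ (hM.box_var_mem_of_box_letterSum_mem h b hb)))
    exact (hγ M hM).1 (hM.mem_of_derivableSt (.of_box_imp hstep))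

theorem exists_list_of_box_var_mem (Ω : List (Fml A P)) :
    ∃ L : List A, ∀ a χ, .box (.var a) χ ∈ Ω → a ∈ L := by
  refine ⟨Ω.filterMap fun | .box (.var a) _ => some a | _ => none, fun a χ h => ?_⟩
  exact List.mem_filterMap.2 ⟨_, h, rfl⟩

theorem derivableSt_of_valid {φ : Fml A P} (h : Valid (GRELsts.{u, v, w} A P) φ) :
    DerivableSt φ := by
  refine derivableSt_of_forall_isMCS fun M hM => ?_
  obtain ⟨L, hL⟩ := exists_list_of_box_var_mem φ.lits
  obtain ⟨l, X, hX, hX0⟩ := hM.startsRun_profile φ.lits L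
  have hS := wordModel_mem_GRELst.{u, v, w} l X
  refine (truth_lemma (hS.1.wellFounded_strict _) (hX.isLabelling hL) ⟨0⟩ M hM hX0.symm φ
    (List.Subset.refl _)).2 ?_
  rw [h _ ⟨_, hS, rfl⟩]
  exact Set.mem_univ _

end PDLMinus

theorem mainTheorem11 {A : Type u} {P : Type v} (φ : PDLMinus.Fml A P) :
    PDLMinus.Valid (PDLMinus.GRELsts.{u, v, w} A P) φ ↔ PDLMinus.DerivableSt φ :=
  ⟨PDLMinus.derivableSt_of_valid, PDLMinus.DerivableSt.valid⟩
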